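/- Let $\mathcal K$ be a braided star-autonomous category: a (planar) linearly distributive category in the sense of Cockett and Seely, with tensor $(\otimes,e)$, par $(\oplus ,d)$ and linear distributions $q\otimes(s\oplus t)\to(q\otimes s)\oplus t$ and $(p\oplus q)\otimes s\to p\oplus (q\otimes s)$, together with a braiding $c_{p,q}:p\otimes q\to q\otimes p$ of $\otimes$ and, for every object $p$, a chosen right dual $p^*$ and a chosen left dual ${}^*p$, with units $\tau: e\to p^*\oplus p$, $\tau: e\to p\oplus {}^*p$ and counits $\gamma_p:p\otimes p^*\to d$, $\gamma'_p:{}^*p\otimes p\to d$ satisfying the linear triangle identities. Thus arrows $p\otimes t\to d$ correspond to arrows $t\to p^*$ (left currying), and arrows $t\otimes p\to d$ to arrows $t\to{}^*p$ (right currying). Both duals are contravariant functors. Let $\kappa_p:p\to{}^*(p^*)$ and $\kappa'_p:p\to({}^*p)^*$ be the cancellation isomorphisms, i.e. the right currying of $\gamma_p$ and the left currying of $\gamma'_p$. A natural isomorphism $\Sigma_{p,t}:\mathrm{Hom}(p\otimes t,d)\to\mathrm{Hom}(t\otimes p,d)$ corresponds to the natural isomorphism $\sigma_p:p^*\to{}^*p$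 given by the right currying of $\Sigma_{p,p^*}(\gamma_p)$. One calls $\Sigma$, or $\sigma$, a *quasicycle* if for every object $r$ the composite $$r\xrightarrow{\kappa'_r}({}^*r)^*\xrightarrow{(\sigma_r)^*}(r^*)^*\xrightarrow{\sigma_{r^*}}{}^*(r^*)$$ equals $\kappa_r$. A natural automorphism $\theta$ of the identity functor of $\mathcal K$ induces the natural isomorphism $\hat\Sigma^\theta$ that sends $\omega:p\otimes t\to d$ to $$t\otimes p\xrightarrow{c_{t,p}}p\otimes t\xrightarrow{\theta_p\otimes\mathrm{id}_t}p\otimes t\xrightarrow{\omega}d.$$ The canonical $4\pi$-twist $\mathrm{tw}_p:p\to p$ is the composite $$p\cong p\otimes e\xrightarrow{\mathrm{id}\otimes\tau}p\otimes(p^*\oplus p)\to(p\otimes p^*)\oplus p\xrightarrow{c_{p^*,p}^{-1}\oplus \mathrm{id}}(p^*\otimes p)\oplus p\xrightarrow{c_{p,p^*}^{-1}\oplus \mathrm{id}}(p\otimes p^*)\oplus p\xrightarrow{\gamma_p\oplus \mathrm{id}}d\oplus p\cong p.$$ **Theorem.** For every natural automorphism $\theta$ of the identity functor of $\mathcal K$,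 $\hat\Sigma^\theta$ is a quasicycle if and only if, for every object $p$, the composite $$p\xrightarrow{\theta_p}p\xrightarrow{\kappa_p}{}^*(p^*)\xrightarrow{{}^*(\theta_{p^*})}{}^*(p^*)\xrightarrow{\kappa_p^{-1}}p$$ equals $\mathrm{tw}_p$. In particular, $\hat\Sigma^{\mathrm{id}}$ is a quasicycle if and only if $\mathrm{tw}_p=\mathrm{id}_p$ for every object $p$. -/

import Mathlib

open CategoryTheory MonoidalCategory Opposite

universe v u

/-- A second monoidal structure (`par`) on a category. -/
class ParMonoidal (C : Type u) [Category.{v} C] where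
  par : MonoidalCategory C

section Par

variable {C : Type u} [Category.{v} C] [ParMonoidal C]

/-- The par of two objects. -/
abbrev parObj (p q : C) : C :=
  (ParMonoidal.par (C := C)).toMonoidalCategoryStruct.tensorObj p q

variable (C) in
/-- The unit of par, i.e. the dualising object. -/
abbrev parUnit : C := (ParMonoidal.par (C := C)).toMonoidalCategoryStruct.tensorUnit

infixr:70 " ⅋ " => parObj

/-- `id_p ⅋ f`. -/
abbrev parLeft (p : C) {q q' : C} (f : q ⟶ q') : p ⅋ q ⟶ p ⅋ q' :=
  (ParMonoidal.par (C := C)).toMonoidalCategoryStruct.whiskerLeft p f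

/-- `f ⅋ id_q`. -/
abbrev parRight {p p' : C} (f : p ⟶ p') (q : C) : p ⅋ q ⟶ p' ⅋ q :=
  (ParMonoidal.par (C := C)).toMonoidalCategoryStruct.whiskerRight f q

/-- The associator of par. -/
abbrev parAssoc (p q r : C) : (p ⅋ q) ⅋ r ≅ p ⅋ (q ⅋ r) :=
  (ParMonoidal.par (C := C)).toMonoidalCategoryStruct.associator p q r

/-- The left unitor of par. -/
abbrev parLam (p : C) : parUnit C ⅋ p ≅ p :=
  (ParMonoidal.par (C := C)).toMonoidalCategoryStruct.leftUnitor p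

/-- The right unitor of par. -/
abbrev parRho (p : C) : p ⅋ parUnit C ≅ p :=
  (ParMonoidal.par (C := C)).toMonoidalCategoryStruct.rightUnitor p

end Par

/-- A (planar) linearly distributive category in the sense of Cockett and Seely: two monoidal
structures `⊗`, `⅋` and natural linear distributions, not assumed invertible, subject to the
coherence axioms with the units and the associators. -/
class LinearlyDistributive (C : Type u) [Category.{v} C] [MonoidalCategory C]
    [ParMonoidal C] where
  llcad (q s t : C) : q ⊗ (s ⅋ t) ⟶ (q ⊗ s) ⅋ t
  rrcad (p q s : C) : (p ⅋ q) ⊗ s ⟶ p ⅋ (q ⊗ s)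
  -- naturality of the linear distributions
  llcad_natural_left {q q' : C} (f : q ⟶ q') (s t : C) :
    f ▷ (s ⅋ t) ≫ llcad q' s t = llcad q s t ≫ parRight (f ▷ s) t
  llcad_natural_middle (q : C) {s s' : C} (f : s ⟶ s') (t : C) :
    q ◁ parRight f t ≫ llcad q s' t = llcad q s t ≫ parRight (q ◁ f) t
  llcad_natural_right (q s : C) {t t' : C} (f : t ⟶ t') :
    q ◁ parLeft s f ≫ llcad q s t' = llcad q s t ≫ parLeft (q ⊗ s) f
  rrcad_natural_left {p p' : C} (f : p ⟶ p') (q s : C) :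
    parRight f q ▷ s ≫ rrcad p' q s = rrcad p q s ≫ parRight f (q ⊗ s)
  rrcad_natural_middle (p : C) {q q' : C} (f : q ⟶ q') (s : C) :
    parLeft p f ▷ s ≫ rrcad p q' s = rrcad p q s ≫ parLeft p (f ▷ s)
  rrcad_natural_right (p q : C) {s s' : C} (f : s ⟶ s') :
    (p ⅋ q) ◁ f ≫ rrcad p q s' = rrcad p q s ≫ parLeft p (q ◁ f)
  -- compatibility with the four unit isomorphisms
  llcad_tensor_unit (s t : C) :
    llcad (𝟙_ C) s t ≫ parRight (λ_ s).hom t = (λ_ (s ⅋ t)).hom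
  llcad_par_unit (q s : C) :
    llcad q s (parUnit C) ≫ (parRho (q ⊗ s)).hom = q ◁ (parRho s).hom
  rrcad_tensor_unit (p q : C) :
    rrcad p q (𝟙_ C) ≫ parLeft p (ρ_ q).hom = (ρ_ (p ⅋ q)).hom
  rrcad_par_unit (q s : C) :
    rrcad (parUnit C) q s ≫ (parLam (q ⊗ s)).hom = (parLam q).hom ▷ s
  -- compatibility with the associativity of tensor
  llcad_tensor_assoc (p q s t : C) :
    llcad (p ⊗ q) s t ≫ parRight (α_ p q s).hom t =
      (α_ p q (s ⅋ t)).hom ≫ p ◁ llcad q s t ≫ llcad p (q ⊗ s) t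
  rrcad_tensor_assoc (p q s t : C) :
    (α_ (p ⅋ q) s t).hom ≫ rrcad p q (s ⊗ t) =
      rrcad p q s ▷ t ≫ rrcad p (q ⊗ s) t ≫ parLeft p (α_ q s t).hom
  llcad_rrcad_tensor (p q s t : C) :
    (α_ p (q ⅋ s) t).hom ≫ p ◁ rrcad q s t ≫ llcad p q (s ⊗ t) =
      llcad p q s ▷ t ≫ rrcad (p ⊗ q) s t
  -- compatibility with the associativity of par
  llcad_par_assoc (p q s t : C) :
    p ◁ (parAssoc q s t).hom ≫ llcad p q (s ⅋ t) =
      llcad p (q ⅋ s) t ≫ parRight (llcad p q s) t ≫ (parAssoc (p ⊗ q) s t).hom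
  rrcad_par_assoc (p q s t : C) :
    rrcad (p ⅋ q) s t ≫ (parAssoc p q (s ⊗ t)).hom =
      (parAssoc p q s).hom ▷ t ≫ rrcad p (q ⅋ s) t ≫ parLeft p (rrcad q s t)
  llcad_rrcad_par (p q s t : C) :
    llcad (p ⅋ q) s t ≫ parRight (rrcad p q s) t ≫ (parAssoc p (q ⊗ s) t).hom =
      rrcad p q (s ⅋ t) ≫ parLeft p (llcad q s t)

open LinearlyDistributive

/-- A linear adjunction exhibiting `q` as a right dual of `p` and `p` as a left dual of `q`. -/
structure LinearDual {C : Type u} [Category.{v} C] [MonoidalCategory C] [ParMonoidal C]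
    [LinearlyDistributive C] (p q : C) where
  τ : 𝟙_ C ⟶ q ⅋ p
  γ : p ⊗ q ⟶ parUnit C
  triangle_left :
    (ρ_ p).inv ≫ p ◁ τ ≫ llcad p q p ≫ parRight γ p ≫ (parLam p).hom = 𝟙 p
  triangle_right :
    (λ_ q).inv ≫ τ ▷ q ≫ rrcad q p q ≫ parLeft q γ ≫ (parRho q).hom = 𝟙 q

/-- A star-autonomous category: a linearly distributive category with a chosen right dual
`perp p` (written `p^*`) and a chosen left dual `prep p` (written `^*p`) of every object `p`. -/
class StarAutonomous (C : Type u) [Category.{v} C] [MonoidalCategory C] [ParMonoidal C]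
    extends LinearlyDistributive C where
  perp : C → C
  prep : C → C
  perpDual (p : C) : LinearDual p (perp p)
  prepDual (p : C) : LinearDual (prep p) p

open StarAutonomous

namespace LinearDual

variable {C : Type u} [Category.{v} C] [MonoidalCategory C] [ParMonoidal C]
  [LinearlyDistributive C] {p q : C}

/-- Pairing an arrow `q ⅋ X ⟶ q ⅋ d ≅ q` with `p` through the counit. -/
theorem cut_left (D : LinearDual p q) {X : C} (ω : X ⟶ parUnit C) :
    p ◁ (parLeft q ω ≫ (parRho q).hom) ≫ D.γ =
      llcad p q X ≫ parRight D.γ X ≫ (parLam X).hom ≫ ω := by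
  have h1 : parLeft (p ⊗ q) ω ≫ parRight D.γ _ = parRight D.γ X ≫ parLeft (parUnit C) ω :=
    @MonoidalCategory.whisker_exchange C _ ParMonoidal.par _ _ _ _ D.γ ω
  have h2 : parLeft (parUnit C) ω ≫ (parLam (parUnit C)).hom = (parLam X).hom ≫ ω :=
    @MonoidalCategory.leftUnitor_naturality C _ ParMonoidal.par _ _ ω
  have h3 : parRight D.γ (parUnit C) ≫ (parRho (parUnit C)).hom = (parRho (p ⊗ q)).hom ≫ D.γ :=
    @MonoidalCategory.rightUnitor_naturality C _ ParMonoidal.par _ _ D.γ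
  have h4 : (parLam (parUnit C)).hom = (parRho (parUnit C)).hom :=
    @MonoidalCategory.unitors_equal C _ ParMonoidal.par
  rw [MonoidalCategory.whiskerLeft_comp, Category.assoc, ← llcad_par_unit, Category.assoc, ← h3,
    reassoc_of% (llcad_natural_right p q ω), reassoc_of% h1, ← h4, h2]

/-- Pairing an arrow `X ⅋ p ⟶ d ⅋ p ≅ p` with `q` through the counit. -/
theorem cut_right (D : LinearDual p q) {X : C} (ω : X ⟶ parUnit C) :
    (parRight ω p ≫ (parLam p).hom) ▷ q ≫ D.γ =
      rrcad X p q ≫ parLeft X D.γ ≫ (parRho X).hom ≫ ω := by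
  have h1 : parLeft X D.γ ≫ parRight ω _ = parRight ω (p ⊗ q) ≫ parLeft (parUnit C) D.γ :=
    @MonoidalCategory.whisker_exchange C _ ParMonoidal.par _ _ _ _ ω D.γ
  have h2 : parRight ω (parUnit C) ≫ (parRho (parUnit C)).hom = (parRho X).hom ≫ ω :=
    @MonoidalCategory.rightUnitor_naturality C _ ParMonoidal.par _ _ ω
  have h3 : parLeft (parUnit C) D.γ ≫ (parLam (parUnit C)).hom = (parLam (p ⊗ q)).hom ≫ D.γ :=
    @MonoidalCategory.leftUnitor_naturality C _ ParMonoidal.par _ _ D.γ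
  have h4 : (parLam (parUnit C)).hom = (parRho (parUnit C)).hom :=
    @MonoidalCategory.unitors_equal C _ ParMonoidal.par
  rw [MonoidalCategory.comp_whiskerRight, Category.assoc, ← rrcad_par_unit, Category.assoc, ← h3,
    reassoc_of% (rrcad_natural_left ω p q), ← reassoc_of% h1, h4, h2]

/-- Left currying: arrows `p ⊗ t ⟶ d` correspond to arrows `t ⟶ q`. -/
def lCurry (D : LinearDual p q) (t : C) : (p ⊗ t ⟶ parUnit C) ≃ (t ⟶ q) where
  toFun ω := (λ_ t).inv ≫ D.τ ▷ t ≫ rrcad q p t ≫ parLeft q ω ≫ (parRho q).hom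
  invFun f := p ◁ f ≫ D.γ
  left_inv ω := by
    have h := congrArg (fun k => k ▷ t ≫ ω) D.triangle_left
    simp only [MonoidalCategory.comp_whiskerRight, Category.assoc,
      MonoidalCategory.id_whiskerRight, Category.id_comp] at h
    rw [← rrcad_par_unit, ] at h
    simp only [Category.assoc] at h
    rw [reassoc_of% (rrcad_natural_left D.γ p t), ← reassoc_of% (llcad_rrcad_tensor p q p t)] at h
    simp only [MonoidalCategory.whiskerLeft_comp, Category.assoc]
    have c := cut_left D ω
    simp only [MonoidalCategory.whiskerLeft_comp, Category.assoc] at c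
    rw [c]
    refine Eq.trans ?_ h
    simp
  right_inv f := by
    have h : parLeft q (p ◁ f ≫ D.γ) = parLeft q (p ◁ f) ≫ parLeft q D.γ :=
      @MonoidalCategory.whiskerLeft_comp C _ ParMonoidal.par _ _ _ _ _ _
    beta_reduce
    rw [h, Category.assoc, ← reassoc_of% (rrcad_natural_right q p f),
      ← reassoc_of% (MonoidalCategory.whisker_exchange D.τ f),
      ← reassoc_of% (MonoidalCategory.leftUnitor_inv_naturality f), D.triangle_right,
      Category.comp_id]

/-- Right currying: arrows `t ⊗ q ⟶ d` correspond to arrows `t ⟶ p`. -/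
def rCurry (D : LinearDual p q) (t : C) : (t ⊗ q ⟶ parUnit C) ≃ (t ⟶ p) where
  toFun ψ := (ρ_ t).inv ≫ t ◁ D.τ ≫ llcad t q p ≫ parRight ψ p ≫ (parLam p).hom
  invFun f := f ▷ q ≫ D.γ
  left_inv ψ := by
    have h := congrArg (fun k => t ◁ k ≫ ψ) D.triangle_right
    simp only [MonoidalCategory.whiskerLeft_comp, Category.assoc,
      MonoidalCategory.whiskerLeft_id, Category.id_comp] at h
    rw [← llcad_par_unit] at h
    simp only [Category.assoc] at h
    rw [reassoc_of% (llcad_natural_right t q D.γ)] at h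
    simp only [MonoidalCategory.comp_whiskerRight, Category.assoc]
    have c := cut_right D ψ
    simp only [MonoidalCategory.comp_whiskerRight, Category.assoc] at c
    rw [c, ← reassoc_of% (llcad_rrcad_tensor t q p q)]
    refine Eq.trans ?_ h
    simp
  right_inv f := by
    have h : parRight (f ▷ q ≫ D.γ) p = parRight (f ▷ q) p ≫ parRight D.γ p :=
      @MonoidalCategory.comp_whiskerRight C _ ParMonoidal.par _ _ _ _ _ _
    beta_reduce
    rw [h, Category.assoc, ← reassoc_of% (llcad_natural_left f q p),
      reassoc_of% (MonoidalCategory.whisker_exchange f D.τ),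
      ← reassoc_of% (MonoidalCategory.rightUnitor_inv_naturality f), D.triangle_left,
      Category.comp_id]

theorem whiskerLeft_lCurry (D : LinearDual p q) {t : C} (ω : p ⊗ t ⟶ parUnit C) :
    p ◁ D.lCurry t ω ≫ D.γ = ω :=
  (D.lCurry t).symm_apply_apply ω

theorem lCurry_eq_iff (D : LinearDual p q) {t : C} (ω : p ⊗ t ⟶ parUnit C) (f : t ⟶ q) :
    D.lCurry t ω = f ↔ ω = p ◁ f ≫ D.γ :=
  ⟨fun h => (by rw [← h]; exact (D.whiskerLeft_lCurry ω).symm),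
    fun h => (by rw [h]; exact (D.lCurry t).apply_symm_apply f)⟩

theorem rCurry_whiskerRight (D : LinearDual p q) {t : C} (ψ : t ⊗ q ⟶ parUnit C) :
    D.rCurry t ψ ▷ q ≫ D.γ = ψ :=
  (D.rCurry t).symm_apply_apply ψ

theorem rCurry_eq_iff (D : LinearDual p q) {t : C} (ψ : t ⊗ q ⟶ parUnit C) (f : t ⟶ p) :
    D.rCurry t ψ = f ↔ ψ = f ▷ q ≫ D.γ :=
  ⟨fun h => (by rw [← h]; exact (D.rCurry_whiskerRight ψ).symm),
    fun h => (by rw [h]; exact (D.rCurry t).apply_symm_apply f)⟩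

end LinearDual

section HomCyclicity

variable {C : Type u} [Category.{v} C] [MonoidalCategory C] [ParMonoidal C]

variable (C) in
/-- A natural isomorphism `Σ_{p,t} : Hom(p ⊗ t, d) ≅ Hom(t ⊗ p, d)`. -/
structure HomCyclicity where
  app (p t : C) : (p ⊗ t ⟶ parUnit C) ≃ (t ⊗ p ⟶ parUnit C)
  natural {p p' t t' : C} (f : p ⟶ p') (g : t ⟶ t') (ω : p' ⊗ t' ⟶ parUnit C) :
    app p t ((f ⊗ₘ g) ≫ ω) = (g ⊗ₘ f) ≫ app p' t' ω

namespace HomCyclicity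

theorem natural_left (S : HomCyclicity C) {p p' : C} (f : p ⟶ p') (t : C)
    (ω : p' ⊗ t ⟶ parUnit C) : S.app p t (f ▷ t ≫ ω) = t ◁ f ≫ S.app p' t ω := by
  simpa using S.natural f (𝟙 t) ω

theorem natural_right (S : HomCyclicity C) (p : C) {t t' : C} (g : t ⟶ t')
    (ω : p ⊗ t' ⟶ parUnit C) : S.app p t (p ◁ g ≫ ω) = g ▷ p ≫ S.app p t' ω := by
  simpa using S.natural (𝟙 p) g ω

theorem natural_symm (S : HomCyclicity C) (p : C) {t t' : C} (g : t ⟶ t')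
    (ω : t' ⊗ p ⟶ parUnit C) :
    (S.app p t).symm (g ▷ p ≫ ω) = p ◁ g ≫ (S.app p t').symm ω := by
  rw [Equiv.symm_apply_eq, natural_right, Equiv.apply_symm_apply]

end HomCyclicity

end HomCyclicity

section StarAut

variable {C : Type u} [Category.{v} C] [MonoidalCategory C] [ParMonoidal C] [StarAutonomous C]

/-- The right dual `f^* : q^* ⟶ p^*` of an arrow `f : p ⟶ q`. -/
def perpMap {p q : C} (f : p ⟶ q) : perp q ⟶ perp p :=
  (perpDual p).lCurry (perp q) (f ▷ perp q ≫ (perpDual q).γ)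

/-- The left dual `^*f : ^*q ⟶ ^*p` of an arrow `f : p ⟶ q`. -/
def prepMap {p q : C} (f : p ⟶ q) : prep q ⟶ prep p :=
  (prepDual p).rCurry (prep q) (prep q ◁ f ≫ (prepDual q).γ)

theorem perpMap_spec {p q : C} (f : p ⟶ q) :
    p ◁ perpMap f ≫ (perpDual p).γ = f ▷ perp q ≫ (perpDual q).γ :=
  (perpDual p).whiskerLeft_lCurry _

theorem prepMap_spec {p q : C} (f : p ⟶ q) :
    prepMap f ▷ p ≫ (prepDual p).γ = prep q ◁ f ≫ (prepDual q).γ :=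
  (prepDual p).rCurry_whiskerRight _

variable (C) in
/-- The contravariant functor `p ↦ p^*`. -/
def perpFunctor : Cᵒᵖ ⥤ C where
  obj p := perp p.unop
  map f := perpMap f.unop
  map_id p := by simp [perpMap, LinearDual.lCurry_eq_iff]
  map_comp {p q r} f g := by
    rw [perpMap, LinearDual.lCurry_eq_iff, MonoidalCategory.whiskerLeft_comp, Category.assoc,
      perpMap_spec, MonoidalCategory.whisker_exchange_assoc, perpMap_spec]
    simp

variable (C) in
/-- The contravariant functor `p ↦ ^*p`. -/
def prepFunctor : Cᵒᵖ ⥤ C where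
  obj p := prep p.unop
  map f := prepMap f.unop
  map_id p := by simp [prepMap, LinearDual.rCurry_eq_iff]
  map_comp {p q r} f g := by
    rw [prepMap, LinearDual.rCurry_eq_iff, MonoidalCategory.comp_whiskerRight, Category.assoc,
      prepMap_spec, ← MonoidalCategory.whisker_exchange_assoc, prepMap_spec]
    simp

/-- The cancellation isomorphism `p ≅ ^*(p^*)`. -/
def cancelPrepPerp (p : C) : p ≅ prep (perp p) where
  hom := (prepDual (perp p)).rCurry p (perpDual p).γ
  inv := (perpDual p).rCurry (prep (perp p)) (prepDual (perp p)).γ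
  hom_inv_id := by
    apply ((perpDual p).rCurry p).symm.injective
    change (_ ≫ _) ▷ perp p ≫ (perpDual p).γ = 𝟙 p ▷ perp p ≫ (perpDual p).γ
    simp [LinearDual.rCurry_whiskerRight]
  inv_hom_id := by
    apply ((prepDual (perp p)).rCurry _).symm.injective
    change (_ ≫ _) ▷ perp p ≫ (prepDual (perp p)).γ = 𝟙 _ ▷ perp p ≫ (prepDual (perp p)).γ
    simp [LinearDual.rCurry_whiskerRight]

/-- The cancellation isomorphism `p ≅ (^*p)^*`. -/
def cancelPerpPrep (p : C) : p ≅ perp (prep p) where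
  hom := (perpDual (prep p)).lCurry p (prepDual p).γ
  inv := (prepDual p).lCurry (perp (prep p)) (perpDual (prep p)).γ
  hom_inv_id := by
    apply ((prepDual p).lCurry p).symm.injective
    change prep p ◁ (_ ≫ _) ≫ (prepDual p).γ = prep p ◁ 𝟙 p ≫ (prepDual p).γ
    simp [LinearDual.whiskerLeft_lCurry]
  inv_hom_id := by
    apply ((perpDual (prep p)).lCurry _).symm.injective
    change prep p ◁ (_ ≫ _) ≫ (perpDual (prep p)).γ = prep p ◁ 𝟙 _ ≫ (perpDual (prep p)).γ
    simp [LinearDual.whiskerLeft_lCurry]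

/-- A natural isomorphism `σ_p : p^* ≅ ^*p` is a quasicycle if, for every `r`, the composite
`r ⟶ (^*r)^* ⟶ (r^*)^* ⟶ ^*(r^*)` of the cancellation isomorphism, `(σ_r)^*` and `σ_{r^*}` is the
cancellation isomorphism `r ⟶ ^*(r^*)`. -/
def IsQuasicycle (σ : perpFunctor C ≅ prepFunctor C) : Prop :=
  ∀ r : C, (cancelPerpPrep r).hom ≫ perpMap (σ.hom.app (op r)) ≫ σ.hom.app (op (perp r)) =
    (cancelPrepPerp r).hom

namespace HomCyclicity

/-- The component `σ_p : p^* ≅ ^*p` corresponding to `Σ`: the right currying of `Σ_{p,p^*}(γ_p)`,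
where `γ_p : p ⊗ p^* ⟶ d`, the counit of the duality, is the left uncurrying of the identity of
`p^*`. -/
def component (S : HomCyclicity C) (p : C) : perp p ≅ prep p where
  hom := (prepDual p).rCurry (perp p) (S.app p (perp p) (perpDual p).γ)
  inv := (perpDual p).lCurry (prep p) ((S.app p (prep p)).symm (prepDual p).γ)
  hom_inv_id := by
    apply ((perpDual p).lCurry _).symm.injective
    change p ◁ (_ ≫ _) ≫ (perpDual p).γ = p ◁ 𝟙 _ ≫ (perpDual p).γ
    rw [MonoidalCategory.whiskerLeft_comp, Category.assoc, LinearDual.whiskerLeft_lCurry,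
      ← natural_symm, Equiv.symm_apply_eq, LinearDual.rCurry_whiskerRight]
    simp
  inv_hom_id := by
    apply ((prepDual p).rCurry _).symm.injective
    change (_ ≫ _) ▷ p ≫ (prepDual p).γ = 𝟙 _ ▷ p ≫ (prepDual p).γ
    rw [MonoidalCategory.comp_whiskerRight, Category.assoc, LinearDual.rCurry_whiskerRight,
      ← natural_right, LinearDual.whiskerLeft_lCurry, Equiv.apply_symm_apply]
    simp

theorem component_natural (S : HomCyclicity C) {p q : C} (f : p ⟶ q) :
    perpMap f ≫ (S.component p).hom = (S.component q).hom ≫ prepMap f := by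
  apply ((prepDual p).rCurry _).symm.injective
  change (_ ≫ _) ▷ p ≫ (prepDual p).γ = (_ ≫ _) ▷ p ≫ (prepDual p).γ
  simp only [MonoidalCategory.comp_whiskerRight, Category.assoc, prepMap_spec]
  rw [← MonoidalCategory.whisker_exchange_assoc]
  simp only [component, LinearDual.rCurry_whiskerRight]
  rw [← natural_right, perpMap_spec, natural_left]

/-- The natural isomorphism `σ_p : p^* ≅ ^*p` corresponding to `Σ`. -/
def toNatIso (S : HomCyclicity C) : perpFunctor C ≅ prepFunctor C :=
  NatIso.ofComponents (fun p => S.component p.unop) (fun f => S.component_natural f.unop)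

end HomCyclicity

end StarAut

section Braided

variable {C : Type u} [Category.{v} C] [MonoidalCategory C] [BraidedCategory C]
  [ParMonoidal C] [StarAutonomous C]

/-- The `Σ` induced by a natural automorphism `θ` of the identity functor:
`Σ_{p,t}(ω) : t ⊗ p ⟶ p ⊗ t ⟶ p ⊗ t ⟶ d` is the braiding, followed by `θ_p ⊗ id_t`, followed
by `ω`. -/
def inducedHomCyclicity (θ : 𝟭 C ≅ 𝟭 C) : HomCyclicity C where
  app p t :=
    { toFun := fun ω => (β_ t p).hom ≫ θ.hom.app p ▷ t ≫ ω
      invFun := fun ψ => θ.inv.app p ▷ t ≫ (β_ t p).inv ≫ ψ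
      left_inv := fun ω => by
        simp [← MonoidalCategory.comp_whiskerRight_assoc]
      right_inv := fun ψ => by
        simp }
  natural {p p' t t'} f g ω := by
    have h := θ.hom.naturality f
    simp only [Functor.id_obj, Functor.id_map] at h
    have h1 := congrArg (fun k => k ▷ t ≫ p' ◁ g ≫ ω) h
    simp only [MonoidalCategory.comp_whiskerRight, Category.assoc] at h1
    simp only [Equiv.coe_fn_mk, MonoidalCategory.tensorHom_def (C := C) f g, Category.assoc, ← h1]
    have h2 : p' ◁ g ≫ θ.hom.app p' ▷ t' = θ.hom.app p' ▷ t ≫ p' ◁ g :=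
      MonoidalCategory.whisker_exchange (θ.hom.app p') g
    rw [← reassoc_of% h2, ← BraidedCategory.braiding_naturality_right_assoc,
      ← BraidedCategory.braiding_naturality_left_assoc,
      MonoidalCategory.tensorHom_def'_assoc g f]

/-- The canonical `4π`-twist of `p`: the composite
`p ⟶ p ⊗ e ⟶ p ⊗ (p^* ⅋ p) ⟶ (p ⊗ p^*) ⅋ p ⟶ (p^* ⊗ p) ⅋ p ⟶ (p ⊗ p^*) ⅋ p ⟶ d ⅋ p ⟶ p`
of the unit of the duality `p ⊣ p^*`, the linear distribution, two inverse braidings and the counit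
of the same duality. -/
def fourPiTwist (p : C) : p ⟶ p :=
  (ρ_ p).inv ≫ p ◁ (perpDual p).τ ≫ llcad p (perp p) p ≫
    parRight ((β_ (perp p) p).inv ≫ (β_ p (perp p)).inv ≫ (perpDual p).γ) p ≫ (parLam p).hom

end Braided

/-! Right currying is a bijection, so an equation between arrows into `p` may be tested after
whiskering with `p^*` and composing with `γ_p`; every term of the theorem becomes simple under this
test. For any `Σ`, naturality absorbs the cancellation arrows, and the quasicycle condition at `r`
becomes `Σ(Σ(γ_r)) = γ_r` (`HomCyclicity.isQuasicycle_iff`). For the `Σ` induced by `θ`, applying it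
twice precomposes `γ_p` with the double braiding and `θ_p ⊗ θ_{p^*}`. The composite built from `θ`
and its left dual uncurries to `(θ_p ⊗ θ_{p^*}) ≫ γ_p`, and the twist uncurries to `γ_p` precomposed
with the inverse double braiding. Moving the invertible double braiding across the equation
identifies the two conditions. -/

theorem inducedHomCyclicity_app_app {C : Type u} [Category.{v} C] [MonoidalCategory C]
    [BraidedCategory C] [ParMonoidal C] (θ : 𝟭 C ≅ 𝟭 C) (p t : C) (ω : p ⊗ t ⟶ parUnit C) :
    (inducedHomCyclicity θ).app t p ((inducedHomCyclicity θ).app p t ω) =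
      (β_ p t).hom ≫ (β_ t p).hom ≫ θ.hom.app p ▷ t ≫ p ◁ θ.hom.app t ≫ ω := by
  change (β_ p t).hom ≫ θ.hom.app t ▷ p ≫ (β_ t p).hom ≫ θ.hom.app p ▷ t ≫ ω = _
  -- The second application puts `θ_t` before the inner braiding; naturality of the braiding carries
  -- it past, so that both braidings come first.
  have h : p ◁ θ.hom.app t ≫ θ.hom.app p ▷ t = θ.hom.app p ▷ t ≫ p ◁ θ.hom.app t :=
    MonoidalCategory.whisker_exchange (θ.hom.app p) (θ.hom.app t)
  have h' : θ.hom.app t ▷ p ≫ (β_ t p).hom = (β_ t p).hom ≫ p ◁ θ.hom.app t :=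
    BraidedCategory.braiding_naturality_left (θ.hom.app t) p
  rw [reassoc_of% h', reassoc_of% h]

section Twist

variable {C : Type u} [Category.{v} C] [MonoidalCategory C] [ParMonoidal C] [StarAutonomous C]

/-- This equation characterises `κ_p`, which is defined as a right currying of `γ_p`; under the
counit test `κ_p` simply turns one counit into the other. -/
theorem cancelPrepPerp_hom_spec (p : C) :
    (cancelPrepPerp p).hom ▷ perp p ≫ (prepDual (perp p)).γ = (perpDual p).γ :=
  (prepDual (perp p)).rCurry_whiskerRight _

theorem cancelPrepPerp_inv_spec (p : C) :
    (cancelPrepPerp p).inv ▷ perp p ≫ (perpDual p).γ = (prepDual (perp p)).γ :=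
  (perpDual p).rCurry_whiskerRight _

theorem cancelPerpPrep_hom_spec (p : C) :
    prep p ◁ (cancelPerpPrep p).hom ≫ (perpDual (prep p)).γ = (prepDual p).γ :=
  (perpDual (prep p)).whiskerLeft_lCurry _

/-- Arrows into `p` are equal when their right uncurryings are. -/
theorem LinearDual.whiskerRight_counit_inj {p q : C} (D : LinearDual p q) {t : C} {f g : t ⟶ p} :
    f ▷ q ≫ D.γ = g ▷ q ≫ D.γ ↔ f = g :=
  (D.rCurry t).symm.injective.eq_iff

theorem HomCyclicity.component_spec (S : HomCyclicity C) (p : C) :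
    (S.component p).hom ▷ p ≫ (prepDual p).γ = S.app p (perp p) (perpDual p).γ :=
  (prepDual p).rCurry_whiskerRight _

/-- `Σ` is a quasicycle if and only if applying it twice to each counit `γ_r` gives `γ_r` back. -/
theorem HomCyclicity.isQuasicycle_iff (S : HomCyclicity C) :
    IsQuasicycle S.toNatIso ↔
      ∀ r : C, S.app (perp r) r (S.app r (perp r) (perpDual r).γ) = (perpDual r).γ := by
  refine forall_congr' fun r => ?_
  change (cancelPerpPrep r).hom ≫ perpMap (S.component r).hom ≫ (S.component (perp r)).hom = _ ↔ _
  -- Both sides are arrows into `^*(r^*)`, so they are tested against the counit `^*(r^*) ⊗ r^* ⟶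
  -- d`; `κ_r` turns into `γ_r`.
  rw [← (prepDual (perp r)).whiskerRight_counit_inj, cancelPrepPerp_hom_spec]
  simp only [MonoidalCategory.comp_whiskerRight, Category.assoc, component_spec]
  -- Naturality moves `κ'_r` and `(σ_r)^*` inside the outer `Σ`. There `(σ_r)^*` slides across the
  -- pairing to become `σ_r` on the other factor, `κ'_r` turns the counit of `^*r ⊣ (^*r)^*` into
  -- `γ'_r`, and `σ_r` paired with `γ'_r` is `Σ(γ_r)`.
  rw [← S.natural_right, ← S.natural_right, perpMap_spec, MonoidalCategory.whisker_exchange_assoc,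
    cancelPerpPrep_hom_spec, component_spec]

/-- The right uncurrying of `f` followed by the conjugate of `^*g` by the cancellation isomorphism. -/
theorem comp_prepMap_whiskerRight_counit {p : C} (f : p ⟶ p) (g : perp p ⟶ perp p) :
    (f ≫ (cancelPrepPerp p).hom ≫ prepMap g ≫ (cancelPrepPerp p).inv) ▷ perp p ≫
      (perpDual p).γ = f ▷ perp p ≫ p ◁ g ≫ (perpDual p).γ := by
  simp only [MonoidalCategory.comp_whiskerRight, Category.assoc, cancelPrepPerp_inv_spec,
    prepMap_spec]
  -- `^*g` has already become `g` acting on `p^*`; exchanging it with `κ_p` lets `κ_p` meet the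
  -- counit and disappear.
  rw [← MonoidalCategory.whisker_exchange_assoc, cancelPrepPerp_hom_spec]

/-- The composite defining the twist is literally the formula for the right currying of `γ_p`
precomposed with two inverse braidings, so uncurrying recovers that arrow. -/
theorem fourPiTwist_whiskerRight_counit [BraidedCategory C] (p : C) :
    fourPiTwist p ▷ perp p ≫ (perpDual p).γ =
      (β_ (perp p) p).inv ≫ (β_ p (perp p)).inv ≫ (perpDual p).γ :=
  (perpDual p).rCurry_whiskerRight _

theorem isQuasicycle_inducedHomCyclicity_iff [BraidedCategory C] (θ : 𝟭 C ≅ 𝟭 C) :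
    IsQuasicycle (inducedHomCyclicity θ).toNatIso ↔
      ∀ p : C, θ.hom.app p ≫ (cancelPrepPerp p).hom ≫
        prepMap (θ.hom.app (perp p)) ≫ (cancelPrepPerp p).inv = fourPiTwist p := by
  rw [HomCyclicity.isQuasicycle_iff]
  refine forall_congr' fun p => ?_
  -- The equation of endomorphisms of `p` is replaced by its right uncurrying, with both sides then
  -- evaluated.
  refine Iff.trans ?_ (perpDual p).whiskerRight_counit_inj
  refine Iff.trans ?_ (Eq.congr (comp_prepMap_whiskerRight_counit (θ.hom.app p)
    (θ.hom.app (perp p))) (fourPiTwist_whiskerRight_counit p)).symm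
  -- The two inverse braidings on the twist side cross over as the double braiding produced by `Σ`
  -- applied twice.
  rw [inducedHomCyclicity_app_app, Iso.eq_inv_comp, Iso.eq_inv_comp]
  rfl

end Twist

theorem theorem4p6 {C : Type u} [Category.{v} C] [MonoidalCategory C] [BraidedCategory C]
    [ParMonoidal C] [StarAutonomous C] :
    (∀ θ : 𝟭 C ≅ 𝟭 C,
      IsQuasicycle (inducedHomCyclicity θ).toNatIso ↔
        ∀ p : C, θ.hom.app p ≫ (cancelPrepPerp p).hom ≫
          prepMap (θ.hom.app (perp p)) ≫ (cancelPrepPerp p).inv = fourPiTwist p) ∧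
    (IsQuasicycle (inducedHomCyclicity (Iso.refl (𝟭 C))).toNatIso ↔
      ∀ p : C, fourPiTwist p = 𝟙 p) := by
  refine ⟨isQuasicycle_inducedHomCyclicity_iff, ?_⟩
  rw [isQuasicycle_inducedHomCyclicity_iff]
  refine forall_congr' fun p => ?_
  have h : prepMap (𝟙 (perp p)) = 𝟙 _ := (prepFunctor C).map_id (op (perp p))
  -- For `θ = id` the left dual of an identity is an identity, so the conjugation by `κ_p` cancels
  -- and only `𝟙 p = tw_p` is left.
  change 𝟙 p ≫ (cancelPrepPerp p).hom ≫ prepMap (𝟙 (perp p)) ≫ (cancelPrepPerp p).inv = _ ↔ _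
  rw [h, Category.id_comp, Category.id_comp, Iso.hom_inv_id]
  exact eq_comm
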